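/- Let $\Omega$ be a compact metrizable abelian topological group (written additively) with Haar measure $\mu_\Omega$, and let $\psi:\mathbb R\to\Omega$ be a continuous homomorphism with dense image. For $U:\Omega\to\mathbb R$ put $\partial_\psi U(\omega)=\lim_{t\to0}\frac{U(\omega+\psi(t))-U(\omega)}{t}$, and let $\mathcal C^2_\psi(\Omega)$ be the set of continuous $U:\Omega\to\mathbb R$ for which $\partial_\psi U$ and $\partial_\psi^2U=\partial_\psi(\partial_\psi U)$ exist everywhere on $\Omega$ and are continuous. Let $0<a<b$ and let $P\in\mathcal C^2_\psi(\Omega)$ satisfy $a\le P(\omega)\le b$ for all $\omega\in\Omega$. For $\omega\in\Omega$ put $p_\omega(t)=P(\omega+\psi(t))$, $t\in\mathbb R$, and let $$v_*=2\max\Big\{\max_{\varpi\in\Omega}\partial_\psi P(\varpi),\,0\Big\}.$$ The ping-pong map with forcing $p=p_\omega$ is the map $(t_0,v_0)\mapsto(t_1,v_1)$ defined on $\mathbb R\times(v_*,\infty)$ by $$v_1=v_0-2\dot p(\tilde t),\qquad t_1=\tilde t+\frac{p(\tilde t)}{v_1},$$ where $\tilde t=\tilde t(t_0,v_0)$ is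 the unique solution of $(\tilde t-t_0)v_0=p(\tilde t)$. Let $$E_\omega=\Big\{(t_0,v_0)\in\mathbb R\times(v_*,\infty):\ (t_n,v_n)_{n\in\mathbb N}\text{ is well defined and }\lim_{n\to\infty}v_n=\infty\Big\},$$ where $(t_n,v_n)$ is the $n$-th iterate of $(t_0,v_0)$ under this map, and "well defined" means that $v_n>v_*$ for all $n\ge0$, so that the map can be applied again at each step. Then for $\mu_\Omega$-almost every $\omega\in\Omega$ the set $E_\omega\subset\mathbb R^2$ has Lebesgue measure zero. -/

import Mathlib

noncomputable section

namespace PingPong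

section Flow

variable {Ω : Type*} [AddCommGroup Ω]

/-- The derivative along the flow `ω · t = ω + ψ t`, i.e. the limit of
`(U (ω + ψ t) - U ω) / t` as `t → 0`, `t ≠ 0`. -/
def flowDeriv (ψ : ℝ →+ Ω) (U : Ω → ℝ) (ω : Ω) : ℝ :=
  deriv (fun t : ℝ => U (ω + ψ t)) 0

/-- `U` is differentiable along the flow at every point of `Ω`. -/
def FlowDifferentiable (ψ : ℝ →+ Ω) (U : Ω → ℝ) : Prop :=
  ∀ ω : Ω, DifferentiableAt ℝ (fun t : ℝ => U (ω + ψ t)) 0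

/-- The class `C^k_ψ(Ω)`: `U` is continuous and its derivatives along the flow up to order `k`
exist everywhere on `Ω` and are continuous on `Ω`. -/
def IsCPsi [TopologicalSpace Ω] (ψ : ℝ →+ Ω) : ℕ → (Ω → ℝ) → Prop
  | 0, U => Continuous U
  | k + 1, U => Continuous U ∧ FlowDifferentiable ψ U ∧ IsCPsi ψ k (flowDeriv ψ U)

/-- The velocity threshold `v_* = 2 max {max_ϖ ∂_ψ P(ϖ), 0}`. -/
def vStar (ψ : ℝ →+ Ω) (P : Ω → ℝ) : ℝ :=
  2 * max (⨆ ϖ : Ω, flowDeriv ψ P ϖ) 0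

end Flow

/-- A particle leaving `x = 0` at time `t₀` with velocity `v₀` meets the plate `x = p(t)` at
time `s`. -/
def IsImpactTime (p : ℝ → ℝ) (t₀ v₀ s : ℝ) : Prop :=
  (s - t₀) * v₀ = p s

/-- For `v₀` above the velocity threshold the impact time exists and is unique. -/
theorem existsUnique_isImpactTime {p : ℝ → ℝ} (hp : Differentiable ℝ p) {b M : ℝ}
    (hpos : ∀ t, 0 < p t) (hb : ∀ t, p t ≤ b) (hM : ∀ t, deriv p t ≤ M)
    (t₀ : ℝ) {v₀ : ℝ} (hv : 2 * max M 0 < v₀) :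
    ∃! s, IsImpactTime p t₀ v₀ s := by
  have hv0 : 0 < v₀ := by
    have := le_max_right M 0
    linarith
  have hMv : M < v₀ := by
    have h1 := le_max_left M 0
    have h2 := le_max_right M 0
    linarith
  have hd : ∀ s, HasDerivAt (fun s => (s - t₀) * v₀ - p s) (1 * v₀ - deriv p s) s := fun s =>
    (((hasDerivAt_id s).sub_const t₀).mul_const v₀).sub (hp s).hasDerivAt
  have hmono : StrictMono (fun s => (s - t₀) * v₀ - p s) := by
    apply strictMono_of_deriv_pos
    intro s
    rw [(hd s).deriv]
    have := hM s
    linarith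
  have hcont : Continuous (fun s => (s - t₀) * v₀ - p s) :=
    continuous_iff_continuousAt.2 fun s => (hd s).continuousAt
  have hbpos : 0 < b := (hpos t₀).trans_le (hb t₀)
  have hle : t₀ ≤ t₀ + b / v₀ := by
    have : 0 < b / v₀ := by positivity
    linarith
  have hmem : (0 : ℝ) ∈ Set.Icc ((fun s => (s - t₀) * v₀ - p s) t₀)
      ((fun s => (s - t₀) * v₀ - p s) (t₀ + b / v₀)) := by
    constructor
    · have := hpos t₀
      simp only [sub_self, zero_mul, zero_sub]
      linarith
    · have h1 := hb (t₀ + b / v₀)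
      have h2 : (t₀ + b / v₀ - t₀) * v₀ = b := by
        field_simp
        ring
      simp only [h2]
      linarith
  obtain ⟨s, -, hs⟩ := intermediate_value_Icc hle hcont.continuousOn hmem
  refine ⟨s, ?_, fun r hr => ?_⟩
  · exact sub_eq_zero.1 hs
  · apply hmono.injective
    exact (sub_eq_zero.2 hr).trans hs.symm

/-- The time `t̃(t₀, v₀)` of the impact with the moving plate: the solution of
`(t̃ - t₀) v₀ = p(t̃)`, which is unique on the domain `v₀ > v_*` of the ping-pong map. -/
def impactTime (p : ℝ → ℝ) (t₀ v₀ : ℝ) : ℝ :=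
  Classical.epsilon (IsImpactTime p t₀ v₀)

/-- The ping-pong map `(t₀, v₀) ↦ (t₁, v₁)` for the forcing `p`, where
`v₁ = v₀ - 2 p'(t̃)` and `t₁ = t̃ + p(t̃) / v₁`. It is meaningful for `v₀ > v_*`. -/
def pingPongMap (p : ℝ → ℝ) (x : ℝ × ℝ) : ℝ × ℝ :=
  (impactTime p x.1 x.2 +
      p (impactTime p x.1 x.2) / (x.2 - 2 * deriv p (impactTime p x.1 x.2)),
    x.2 - 2 * deriv p (impactTime p x.1 x.2))

/-- The escaping set of the ping-pong map with forcing `p` and domain `ℝ × (v, ∞)`: the initial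
data whose forward orbit is well defined (it never leaves the domain of the map) and has
`v_n → ∞`. -/
def escapingSet (p : ℝ → ℝ) (v : ℝ) : Set (ℝ × ℝ) :=
  {x | (∀ n : ℕ, v < ((pingPongMap p)^[n] x).2) ∧
    Filter.Tendsto (fun n : ℕ => ((pingPongMap p)^[n] x).2) Filter.atTop Filter.atTop}

end PingPong

end

open MeasureTheory Filter Topology Set
open scoped ENNReal

namespace PingPong

/-! ### Wandering sets -/

section Wandering

/-! The maps for all forcings `p_ω` are lifts of one skew map on `Ω × ℝ`. Let `σ` be the phase at
impact, `v` the incoming and `w = v - 2 Q σ` the outgoing velocity. At fixed `v`, `ω = σ - ψ (P σ /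
v)` has Jacobian `1 - Q σ / v` along the flow. The measure `v dv dμ` thus becomes `(v - Q σ) dv
dμ(σ) = (w + Q σ) dw dμ(σ)`, which is also what the outgoing coordinates give. At high velocity
preimages therefore do not gain measure (`phaseMeasure_preimage_le`).

The action `P v` changes by only `o(1 / v)` per step (`exists_abs_action_sub_le`). An escaping orbit
that starts below a high level `k` of the action must therefore land in a strip of width `2 b ε / k`
above it. The strip has velocities of order `k`, so its measure is `O(ε)`, uniformly in `k`.

Escaping points that are at action at most `m` for the last time form a wandering set whose orbits
all cross such strips. By `measure_le_of_wandering` this set has measure `O(ε)` for every `ε`, hence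
zero. Every escaping orbit visits such a set for some integer `m`, and preimages of null sets are
null, so the escaping set of the skew map is null. Fubini then gives the claim for almost every `ω`.
-/

/-- A wandering set whose orbits all meet `B` is no larger than `B`, for a map that does not
increase the measure of preimages. -/
theorem measure_le_of_wandering {X : Type*} [MeasurableSpace X] (m : Measure X) {f : X → X}
    (hf : Measurable f) {D : Set X} (hD : MeasurableSet D)
    (hsub : ∀ B, MeasurableSet B → B ⊆ D → m (D ∩ f ⁻¹' B) ≤ m B)
    {L : Set X} (hL : MeasurableSet L) (hLD : ∀ x ∈ L, ∀ n, f^[n] x ∈ D)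
    (hw : ∀ x ∈ L, ∀ n, f^[n + 1] x ∉ L)
    {B : Set X} (hB : MeasurableSet B) (hBD : B ⊆ D)
    (hhit : ∀ x ∈ L, ∃ n, f^[n + 1] x ∈ B) : m L ≤ m B := by
  -- `C n`: points that are in `B` after `n + 1` steps, stay in `D` until then, and avoid `L` at
  -- steps `1, …, n`.
  let C : ℕ → Set X := fun n => Nat.rec (D ∩ f ⁻¹' B) (fun _ S => D ∩ f ⁻¹' (S \ L)) n
  have hC0 : C 0 = D ∩ f ⁻¹' B := rfl
  have hCs : ∀ n, C (n + 1) = D ∩ f ⁻¹' (C n \ L) := fun n => rfl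
  have hCD : ∀ n, C n ⊆ D := by
    intro n
    cases n <;> exact inter_subset_left
  have hCm : ∀ n, MeasurableSet (C n) := by
    intro n
    induction n with
    | zero => exact hD.inter (hf hB)
    | succ n ih => exact hD.inter (hf (ih.diff hL))
  -- Each pullback removes the part in `L` from a mass budget of `m B`; only the remainder `C n \ L`
  -- is pulled back further.
  have hsum : ∀ n, ∑ i ∈ Finset.range (n + 1), m (L ∩ C i) + m (C n \ L) ≤ m B := by
    intro n
    induction n with
    | zero =>
      simp only [zero_add, Finset.range_one, Finset.sum_singleton]
      rw [inter_comm, measure_inter_add_sdiff _ hL]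
      exact hsub B hB hBD
    | succ n ih =>
      rw [Finset.sum_range_succ, add_assoc, inter_comm L (C (n + 1)),
        measure_inter_add_sdiff _ hL]
      refine le_trans (add_le_add le_rfl ?_) ih
      exact hsub _ ((hCm n).diff hL) (sdiff_subset.trans (hCD n))
  have hmem : ∀ n x, (∀ i, f^[i] x ∈ D) → f^[n + 1] x ∈ B →
      (∀ i, f^[i + 1] x ∉ L) → x ∈ C n := by
    intro n
    induction n with
    | zero => exact fun x hx h _ => ⟨hx 0, h⟩
    | succ n ih =>
      intro x hx h hl
      exact ⟨hx 0, ih (f x) (fun i => hx (i + 1)) h (fun i => hl (i + 1)), hl 0⟩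
  calc m L ≤ m (⋃ n, L ∩ C n) := by
        refine measure_mono fun x hx => ?_
        obtain ⟨n, hn⟩ := hhit x hx
        exact mem_iUnion.2 ⟨n, hx, hmem n x (hLD x hx) hn (hw x hx)⟩
    _ ≤ ∑' n, m (L ∩ C n) := measure_iUnion_le _
    _ ≤ m B := ENNReal.tsum_le_of_sum_range_le fun n =>
        (Finset.sum_le_sum_of_subset (Finset.range_mono n.le_succ)).trans
          (le_self_add.trans (hsum n))

end Wandering

/-- A `C¹` function pulls null sets back to null sets away from its critical points. -/
theorem volume_preimage_inter_deriv_ne_zero {q q' : ℝ → ℝ} (hq : ∀ s, HasDerivAt q (q' s) s)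
    (hq' : Continuous q') {N : Set ℝ} (hN : MeasurableSet N) (hN0 : volume N = 0) :
    volume {s | q' s ≠ 0 ∧ q s ∈ N} = 0 := by
  have hqc : Continuous q := continuous_iff_continuousAt.2 fun s => (hq s).continuousAt
  refine measure_null_of_locally_null _ fun s hs => ?_
  -- Rolle's theorem gives injectivity on a ball free of critical points; the area formula then
  -- applies there.
  have hinj : ∃ u ∈ 𝓝 s, MeasurableSet u ∧ InjOn q u ∧ ∀ r ∈ u, q' r ≠ 0 := by
    obtain ⟨ε, hε, hball⟩ := Metric.isOpen_iff.1 (isOpen_ne_fun hq' continuous_const) s hs.1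
    refine ⟨Metric.ball s ε, Metric.ball_mem_nhds s hε, measurableSet_ball, ?_, hball⟩
    rw [Real.ball_eq_Ioo] at hball ⊢
    intro x hx y hy hxy
    by_contra hne
    wlog hlt : x < y generalizing x y
    · exact this hy hx hxy.symm (Ne.symm hne) (lt_of_le_of_ne (not_lt.1 hlt) (Ne.symm hne))
    obtain ⟨c, hc, hc0⟩ := exists_hasDerivAt_eq_zero hlt hqc.continuousOn hxy
      (fun z _ => hq z)
    exact hball ⟨hx.1.trans hc.1, hc.2.trans hy.2⟩ hc0
  obtain ⟨u, hu, hum, hui, hu0⟩ := hinj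
  refine ⟨{s | q' s ≠ 0 ∧ q s ∈ N} ∩ u, inter_mem_nhdsWithin _ hu, ?_⟩
  have hSm : MeasurableSet ({s | q' s ≠ 0 ∧ q s ∈ N} ∩ u) :=
    ((isOpen_ne_fun hq' continuous_const).measurableSet.inter (hqc.measurable hN)).inter hum
  have hint := lintegral_image_eq_lintegral_abs_deriv_mul hSm
    (fun x _ => (hq x).hasDerivWithinAt) (hui.mono inter_subset_right) (fun _ => 1)
  have h0 : volume (q '' ({s | q' s ≠ 0 ∧ q s ∈ N} ∩ u)) = 0 := by
    refine measure_mono_null ?_ hN0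
    rintro _ ⟨r, hr, rfl⟩
    exact hr.1.2
  simp only [mul_one, lintegral_const, Measure.restrict_apply MeasurableSet.univ, univ_inter,
    one_mul, h0] at hint
  have hae := (setLIntegral_eq_zero_iff hSm (by fun_prop)).1 hint.symm
  rw [measure_eq_zero_iff_ae_notMem]
  filter_upwards [hae] with x hx hxs
  have := hx hxs
  simp only [ENNReal.ofReal_eq_zero, abs_nonpos_iff] at this
  exact hxs.1.1 this

/-! ### Change of variables along the flow -/

section FlowTransport

variable {Ω : Type*} [AddCommGroup Ω] [TopologicalSpace Ω] [IsTopologicalAddGroup Ω]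
  [SecondCountableTopology Ω] [MeasurableSpace Ω] [BorelSpace Ω]
  {μ : Measure Ω} [SFinite μ] [μ.IsAddLeftInvariant] {ψ : ℝ →+ Ω}

/-- Mass transport along the flow: instead of integrating over `Ω`, integrate over the parameters
of the orbits that the displacement `φ` sends to `[0, 1)`. -/
theorem lintegral_flow_transport (hψ : Continuous ψ) {H : Ω → ℝ≥0∞} (hH : Measurable H)
    {φ : Ω → ℝ} (hφ : Measurable φ) :
    ∫⁻ ω, (∫⁻ s in {s : ℝ | s + φ (ω + ψ s) ∈ Ico (0 : ℝ) 1}, H (ω + ψ s)) ∂μ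
      = ∫⁻ ω, H ω ∂μ := by
  have hψm : Measurable ψ := hψ.measurable
  let G : ℝ → Ω → ℝ≥0∞ := fun s ω => (Ico (0 : ℝ) 1).indicator (fun _ => H ω) (s + φ ω)
  have hG : Measurable fun z : ℝ × Ω => G z.1 z.2 := by
    have hS : MeasurableSet {z : ℝ × Ω | z.1 + φ z.2 ∈ Ico (0 : ℝ) 1} :=
      (measurable_fst.add (hφ.comp measurable_snd)) measurableSet_Ico
    exact (hH.comp measurable_snd).indicator hS
  calc ∫⁻ ω, (∫⁻ s in {s : ℝ | s + φ (ω + ψ s) ∈ Ico (0 : ℝ) 1}, H (ω + ψ s)) ∂μ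
      = ∫⁻ ω, (∫⁻ s : ℝ, G s (ω + ψ s)) ∂μ := by
        refine lintegral_congr fun ω => ?_
        rw [← lintegral_indicator]
        · rfl
        · exact (measurable_id.add (hφ.comp (measurable_const.add hψm))) measurableSet_Ico
    _ = ∫⁻ s : ℝ, ∫⁻ ω, G s (ω + ψ s) ∂μ := by
        refine lintegral_lintegral_swap ?_
        exact (hG.comp (measurable_snd.prodMk
          (measurable_fst.add (hψm.comp measurable_snd)))).aemeasurable
    -- For fixed `s`, `μ` is invariant under translation by `ψ s`; afterwards `s` ranges over an
    -- interval of length one.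
    _ = ∫⁻ s : ℝ, ∫⁻ ω, G s ω ∂μ := lintegral_congr fun s => lintegral_add_right_eq_self (G s) (ψ s)
    _ = ∫⁻ ω, (∫⁻ s : ℝ, G s ω) ∂μ := lintegral_lintegral_swap hG.aemeasurable
    _ = ∫⁻ ω, H ω ∂μ := by
        refine lintegral_congr fun ω => ?_
        have : (fun s : ℝ => G s ω) = (Ico (0 - φ ω) (1 - φ ω)).indicator fun _ => H ω := by
          funext s
          simp only [G, indicator_apply, mem_Ico, sub_le_iff_le_add, lt_sub_iff_add_lt]
        rw [this, lintegral_indicator measurableSet_Ico]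
        simp

/-- Change of variables for a displacement along the flow that is an increasing bijection of each
orbit. -/
theorem lintegral_flow_change_of_variables (hψ : Continuous ψ) {φ κ : Ω → ℝ} (hφ : Measurable φ)
    (hκ : Measurable κ)
    (hd : ∀ ω s, HasDerivAt (fun s : ℝ => s + φ (ω + ψ s)) (κ (ω + ψ s)) s)
    (hpos : ∀ ω, 0 < κ ω) {C : ℝ} (hC : ∀ ω, |φ ω| ≤ C) {g : Ω → ℝ≥0∞} (hg : Measurable g) :
    ∫⁻ ω, ENNReal.ofReal (κ ω) * g (ω + ψ (φ ω)) ∂μ = ∫⁻ ω, g ω ∂μ := by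
  have hψm : Measurable ψ := hψ.measurable
  have hH : Measurable fun ω => ENNReal.ofReal (κ ω) * g (ω + ψ (φ ω)) := by fun_prop
  -- With displacement `φ` on the left and `0` on the right, the claim becomes a one-dimensional
  -- substitution on each orbit.
  rw [← lintegral_flow_transport hψ hH hφ,
    ← lintegral_flow_transport hψ hg (φ := fun _ => 0) measurable_const]
  refine lintegral_congr fun ω => ?_
  set q : ℝ → ℝ := fun s => s + φ (ω + ψ s) with hq
  have hqd : ∀ s, HasDerivAt q (κ (ω + ψ s)) s := hd ω
  have hqc : Continuous q := continuous_iff_continuousAt.2 fun s => (hqd s).continuousAt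
  have hqm : StrictMono q := by
    refine strictMono_of_deriv_pos fun s => ?_
    rw [(hqd s).deriv]
    exact hpos _
  have hsurj : Function.Surjective q := by
    refine hqc.surjective ?_ ?_
    · refine tendsto_atTop_mono (fun s => ?_) (tendsto_atTop_add_const_right _ (-C) tendsto_id)
      have := (abs_le.1 (hC (ω + ψ s))).1
      simp only [hq, id]
      linarith
    · refine tendsto_atBot_mono (fun s => ?_) (tendsto_atBot_add_const_right _ C tendsto_id)
      have := (abs_le.1 (hC (ω + ψ s))).2
      simp only [hq, id]
      linarith
  have hcv := lintegral_image_eq_lintegral_abs_deriv_mul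
    (hqc.measurable (measurableSet_Ico (a := 0) (b := 1)))
    (fun x _ => (hqd x).hasDerivWithinAt) hqm.injective.injOn (fun r => g (ω + ψ r))
  rw [image_preimage_eq _ hsurj] at hcv
  have h01 : {s : ℝ | s + 0 ∈ Ico (0 : ℝ) 1} = Ico 0 1 := by
    simp only [add_zero, ofPred_mem_eq]
  rw [h01, hcv]
  refine setLIntegral_congr_fun (hqc.measurable measurableSet_Ico) fun s _ => ?_
  simp only [abs_of_pos (hpos _), add_assoc, ← map_add, hq]

/-- A displacement along the flow pulls null sets back to null sets away from its critical
points. -/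
theorem measure_flow_preimage_eq_zero (hψ : Continuous ψ) {φ κ : Ω → ℝ} (hφ : Measurable φ)
    (hκ : Continuous κ)
    (hd : ∀ ω s, HasDerivAt (fun s : ℝ => s + φ (ω + ψ s)) (κ (ω + ψ s)) s)
    {N : Set Ω} (hN : MeasurableSet N) (hN0 : μ N = 0) :
    μ {ω | κ ω ≠ 0 ∧ ω + ψ (φ ω) ∈ N} = 0 := by
  have hψm : Measurable ψ := hψ.measurable
  -- By Fubini and invariance, almost every orbit spends a null set of times in `N`.
  have hNae : ∀ᵐ ω ∂μ, volume {s : ℝ | ω + ψ s ∈ N} = 0 := by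
    have hm : MeasurableSet {z : Ω × ℝ | z.1 + ψ z.2 ∈ N} :=
      (measurable_fst.add (hψm.comp measurable_snd)) hN
    have h0 : (μ.prod (volume : Measure ℝ)) {z : Ω × ℝ | z.1 + ψ z.2 ∈ N} = 0 := by
      rw [Measure.prod_apply_symm hm]
      have : ∀ s : ℝ, μ ((fun ω => (ω, s)) ⁻¹' {z : Ω × ℝ | z.1 + ψ z.2 ∈ N}) = 0 := fun s =>
        (measure_preimage_add_right μ (ψ s) N).trans hN0
      exact (lintegral_congr this).trans lintegral_zero
    exact Measure.measure_ae_null_of_prod_null h0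
  have hSm : MeasurableSet {ω | κ ω ≠ 0 ∧ ω + ψ (φ ω) ∈ N} :=
    (isOpen_ne_fun hκ continuous_const).measurableSet.inter
      ((measurable_id.add (hψm.comp hφ)) hN)
  rw [← lintegral_indicator_one hSm,
    ← lintegral_flow_transport hψ (measurable_one.indicator hSm) hφ]
  refine (lintegral_congr_ae ?_).trans lintegral_zero
  filter_upwards [hNae] with ω hω
  have hz := volume_preimage_inter_deriv_ne_zero (hd ω) (by fun_prop)
    ((measurable_const.add hψm) hN) hω
  refine le_antisymm ((setLIntegral_le_lintegral _ _).trans ?_) zero_le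
  have : MeasurableSet {s : ℝ | ω + ψ s ∈ {ω | κ ω ≠ 0 ∧ ω + ψ (φ ω) ∈ N}} :=
    (measurable_const.add hψm) hSm
  refine le_of_eq ((lintegral_indicator_one this).trans ?_)
  convert hz using 3 with s
  simp [add_assoc]

end FlowTransport

/-! ### The measure on the phase space -/

section PhaseMeasure

variable {Ω : Type*} [MeasurableSpace Ω]

/-- The invariant measure `v dv dμ` of the skew map. -/
noncomputable def phaseMeasure (μ : Measure Ω) : Measure (Ω × ℝ) :=
  (μ.prod volume).withDensity fun x => ENNReal.ofReal x.2

theorem phaseMeasure_apply (μ : Measure Ω) [SFinite μ] {B : Set (Ω × ℝ)}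
    (hB : MeasurableSet B) :
    phaseMeasure μ B = ∫⁻ v, ∫⁻ ω, ENNReal.ofReal v * B.indicator 1 (ω, v) ∂μ := by
  have hm : Measurable fun x : Ω × ℝ => ENNReal.ofReal x.2 * B.indicator 1 x :=
    (ENNReal.measurable_ofReal.comp measurable_snd).mul (measurable_one.indicator hB)
  rw [phaseMeasure, withDensity_apply _ hB, ← lintegral_indicator hB,
    ← lintegral_prod_symm _ hm.aemeasurable]
  refine lintegral_congr fun x => ?_
  by_cases hx : x ∈ B <;> simp [hx]

end PhaseMeasure

/-! ### The skew map and its effect on measure -/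

section Dynamics

variable {Ω : Type*} [AddCommGroup Ω] [TopologicalSpace Ω]

/-- `P` is a forcing with values in `[a, b]`, `Q` and `R` are its first two derivatives along the
flow `ψ`, and `c` is a velocity threshold above which the ping-pong map is defined. -/
structure IsForcing (ψ : ℝ →+ Ω) (P Q R : Ω → ℝ) (a b c : ℝ) : Prop where
  continuous_flow : Continuous ψ
  continuous_fst : Continuous P
  continuous_deriv : Continuous Q
  continuous_deriv₂ : Continuous R
  hasDerivAt : ∀ ω s, HasDerivAt (fun t : ℝ => P (ω + ψ t)) (Q (ω + ψ s)) s
  hasDerivAt₂ : ∀ ω s, HasDerivAt (fun t : ℝ => Q (ω + ψ t)) (R (ω + ψ s)) s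
  pos : 0 < a
  lower : ∀ ω, a ≤ P ω
  upper : ∀ ω, P ω ≤ b
  threshold_nonneg : 0 ≤ c
  deriv_le : ∀ ω, 2 * Q ω ≤ c

/-- The time needed to reach the plate from the phase `ω` with velocity `v`. -/
noncomputable def flightTime (ψ : ℝ →+ Ω) (P : Ω → ℝ) (c : ℝ) (x : Ω × ℝ) : ℝ :=
  open Classical in if c < x.2 then impactTime (fun t => P (x.1 + ψ t)) 0 x.2 else 0

/-- The phase and the velocity after the rebound of a particle that hits the plate at phase `σ`
and leaves it with velocity `w`. -/
noncomputable def rebound (ψ : ℝ →+ Ω) (P : Ω → ℝ) (σ : Ω) (w : ℝ) : Ω × ℝ :=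
  (σ + ψ (P σ / w), w)

/-- The ping-pong map on the phase space `Ω × ℝ`, extended by the identity below the
threshold `c`. -/
noncomputable def skewMap (ψ : ℝ →+ Ω) (P Q : Ω → ℝ) (c : ℝ) (x : Ω × ℝ) : Ω × ℝ :=
  open Classical in
  if c < x.2 then
    rebound ψ P (x.1 + ψ (flightTime ψ P c x)) (x.2 - 2 * Q (x.1 + ψ (flightTime ψ P c x)))
  else x

namespace IsForcing

variable {ψ : ℝ →+ Ω} {P Q R : Ω → ℝ} {a b c : ℝ}

theorem P_pos (h : IsForcing ψ P Q R a b c) (ω : Ω) : 0 < P ω := h.pos.trans_le (h.lower ω)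

theorem deriv_lt (h : IsForcing ψ P Q R a b c) {v : ℝ} (hv : c < v) (ω : Ω) : Q ω < v := by
  have h1 := h.deriv_le ω
  have h2 := h.threshold_nonneg
  by_cases hQ : 0 ≤ Q ω <;> linarith

theorem existsUnique_impact (h : IsForcing ψ P Q R a b c) (ω : Ω) (t : ℝ) {v : ℝ} (hv : c < v) :
    ∃! s, IsImpactTime (fun t => P (ω + ψ t)) t v s := by
  have hd : Differentiable ℝ fun t => P (ω + ψ t) := fun s => (h.hasDerivAt ω s).differentiableAt
  refine existsUnique_isImpactTime hd (b := b) (M := c / 2) (fun s => h.P_pos _)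
    (fun s => h.upper _) (fun s => ?_) t ?_
  · rw [(h.hasDerivAt ω s).deriv]
    linarith [h.deriv_le (ω + ψ s)]
  · rw [max_eq_left (by linarith [h.threshold_nonneg])]
    linarith

theorem impactTime_spec (h : IsForcing ψ P Q R a b c) (ω : Ω) (t : ℝ) {v : ℝ} (hv : c < v) :
    IsImpactTime (fun t => P (ω + ψ t)) t v (impactTime (fun t => P (ω + ψ t)) t v) :=
  Classical.epsilon_spec (h.existsUnique_impact ω t hv).exists

theorem flightTime_mul (h : IsForcing ψ P Q R a b c) {x : Ω × ℝ} (hx : c < x.2) :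
    flightTime ψ P c x * x.2 = P (x.1 + ψ (flightTime ψ P c x)) := by
  have := h.impactTime_spec x.1 0 hx
  simpa [IsImpactTime, flightTime, hx] using this

theorem flightTime_eq (h : IsForcing ψ P Q R a b c) {x : Ω × ℝ} (hx : c < x.2) {s : ℝ}
    (hs : s * x.2 = P (x.1 + ψ s)) : flightTime ψ P c x = s := by
  refine (h.existsUnique_impact x.1 0 hx).unique ?_ ?_
  · simpa [IsImpactTime] using h.flightTime_mul hx
  · simpa [IsImpactTime] using hs

/-- The starting time can be absorbed into the phase, and impact times are unique. -/
theorem impactTime_eq (h : IsForcing ψ P Q R a b c) (ω : Ω) (t : ℝ) {v : ℝ} (hv : c < v) :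
    impactTime (fun t => P (ω + ψ t)) t v = t + flightTime ψ P c (ω + ψ t, v) := by
  refine (h.existsUnique_impact ω t hv).unique (h.impactTime_spec ω t hv) ?_
  have := h.flightTime_mul (x := (ω + ψ t, v)) hv
  simp only [IsImpactTime, add_sub_cancel_left, map_add, ← add_assoc]
  exact this

/-- The ping-pong map of the forcing `t ↦ P (ω + ψ t)` is a lift of the skew map. -/
theorem skewMap_lift (h : IsForcing ψ P Q R a b c) (ω : Ω) {x : ℝ × ℝ} (hx : c < x.2) :
    skewMap ψ P Q c (ω + ψ x.1, x.2) =
      (ω + ψ (pingPongMap (fun t => P (ω + ψ t)) x).1,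
        (pingPongMap (fun t => P (ω + ψ t)) x).2) := by
  simp only [skewMap, hx, if_true, rebound, pingPongMap, h.impactTime_eq ω x.1 hx,
    (h.hasDerivAt ω _).deriv, map_add, add_assoc]

theorem skewMap_lift_iterate (h : IsForcing ψ P Q R a b c) (ω : Ω) {x : ℝ × ℝ}
    (n : ℕ) (hx : ∀ i < n, c < ((pingPongMap (fun t => P (ω + ψ t)))^[i] x).2) :
    (skewMap ψ P Q c)^[n] (ω + ψ x.1, x.2) =
      (ω + ψ ((pingPongMap (fun t => P (ω + ψ t)))^[n] x).1,
        ((pingPongMap (fun t => P (ω + ψ t)))^[n] x).2) := by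
  induction n with
  | zero => rfl
  | succ n ih =>
    rw [Function.iterate_succ_apply', Function.iterate_succ_apply',
      ih fun i hi => hx i (hi.trans n.lt_succ_self), h.skewMap_lift ω (hx n n.lt_succ_self)]

/-- Above the threshold `s v - P (ω + ψ s)` increases in `s`. This yields measurability of the
flight time, which is defined by choice. -/
theorem flightTime_lt_iff (h : IsForcing ψ P Q R a b c) {x : Ω × ℝ} (hx : c < x.2) (r : ℝ) :
    flightTime ψ P c x < r ↔ P (x.1 + ψ r) < r * x.2 := by
  have hd : ∀ s, HasDerivAt (fun s => s * x.2 - P (x.1 + ψ s)) (1 * x.2 - Q (x.1 + ψ s)) s :=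
    fun s => ((hasDerivAt_id s).mul_const x.2).sub (h.hasDerivAt x.1 s)
  have hmono : StrictMono fun s => s * x.2 - P (x.1 + ψ s) := by
    refine strictMono_of_deriv_pos fun s => ?_
    rw [(hd s).deriv]
    linarith [h.deriv_lt hx (x.1 + ψ s)]
  rw [← hmono.lt_iff_lt]
  have := h.flightTime_mul hx
  constructor <;> intro h' <;> linarith

/-- The skew map in terms of the phase of the impact. -/
theorem skewMap_of_impact (h : IsForcing ψ P Q R a b c) (σ : Ω) {v : ℝ} (hv : c < v) :
    skewMap ψ P Q c (σ + ψ (-(P σ / v)), v) = rebound ψ P σ (v - 2 * Q σ) := by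
  have hv0 : v ≠ 0 := (h.threshold_nonneg.trans_lt hv).ne'
  have hτ : flightTime ψ P c (σ + ψ (-(P σ / v)), v) = P σ / v := by
    refine h.flightTime_eq hv ?_
    simp only [add_assoc, ← map_add, neg_add_cancel, map_zero, add_zero]
    field_simp
  simp only [skewMap, hv, if_true, hτ, add_assoc, ← map_add, neg_add_cancel, map_zero, add_zero]

theorem hasDerivAt_displacement (h : IsForcing ψ P Q R a b c) (e : ℝ) (ω : Ω) (s : ℝ) :
    HasDerivAt (fun s => s + P (ω + ψ s) / e) (1 + Q (ω + ψ s) / e) s :=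
  (hasDerivAt_id s).add ((h.hasDerivAt ω s).div_const e)

theorem abs_div_le (h : IsForcing ψ P Q R a b c) {v : ℝ} (hv : 0 < v) (ω : Ω) :
    |P ω / v| ≤ b / v := by
  rw [abs_of_pos (div_pos (h.P_pos ω) hv)]
  exact div_le_div_of_nonneg_right (h.upper ω) hv.le

variable [IsTopologicalAddGroup Ω] [MeasurableSpace Ω] [BorelSpace Ω]

theorem measurable_flightTime (h : IsForcing ψ P Q R a b c) :
    Measurable (flightTime ψ P c) := by
  have hP := h.continuous_fst
  refine measurable_of_Iio fun r => ?_
  have : flightTime ψ P c ⁻¹' Iio r =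
      ({x | c < x.2} ∩ {x | P (x.1 + ψ r) < r * x.2}) ∪ ({x | c < x.2}ᶜ ∩ {_x | 0 < r}) := by
    ext x
    by_cases hx : c < x.2
    · simp [hx, h.flightTime_lt_iff hx r]
    · simp [hx, flightTime]
  rw [this]
  have h1 : MeasurableSet {x : Ω × ℝ | c < x.2} := measurableSet_lt measurable_const measurable_snd
  have h2 : MeasurableSet {x : Ω × ℝ | P (x.1 + ψ r) < r * x.2} :=
    (isOpen_lt (by fun_prop) (by fun_prop)).measurableSet
  exact (h1.inter h2).union (h1.compl.inter (MeasurableSet.const _))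

variable [SecondCountableTopology Ω]

theorem measurable_rebound (h : IsForcing ψ P Q R a b c) :
    Measurable fun z : Ω × ℝ => rebound ψ P z.1 z.2 := by
  have hP := h.continuous_fst.measurable
  have hψ := h.continuous_flow.measurable
  unfold rebound
  fun_prop

theorem measurable_skewMap (h : IsForcing ψ P Q R a b c) : Measurable (skewMap ψ P Q c) := by
  have h1 : MeasurableSet {x : Ω × ℝ | c < x.2} := measurableSet_lt measurable_const measurable_snd
  have hT := h.measurable_flightTime
  have hQ := h.continuous_deriv.measurable
  have hψ := h.continuous_flow.measurable
  have hσ : Measurable fun x : Ω × ℝ => x.1 + ψ (flightTime ψ P c x) := by fun_prop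
  refine Measurable.ite h1 ?_ measurable_id
  exact h.measurable_rebound.comp (hσ.prodMk (measurable_snd.sub ((hQ.comp hσ).const_mul 2)))

variable {μ : Measure Ω} [SFinite μ] [μ.IsAddLeftInvariant]

/-- The measure of a preimage, computed in the phase of the impact and the velocity after it. -/
theorem phaseMeasure_preimage (h : IsForcing ψ P Q R a b c) {d : ℝ} (hd : c ≤ d)
    {B : Set (Ω × ℝ)} (hB : MeasurableSet B) :
    phaseMeasure μ ({x | d < x.2} ∩ skewMap ψ P Q c ⁻¹' B) =
      ∫⁻ w, ∫⁻ σ, {z : Ω × ℝ | d < z.2 + 2 * Q z.1}.indicator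
        (fun z => ENNReal.ofReal (z.2 + Q z.1) * B.indicator 1 (rebound ψ P z.1 z.2)) (σ, w) ∂μ := by
  have hPm := h.continuous_fst.measurable
  have hQm := h.continuous_deriv.measurable
  have hψm := h.continuous_flow.measurable
  have hD : MeasurableSet {x : Ω × ℝ | d < x.2} := measurableSet_lt measurable_const measurable_snd
  have hone : Measurable (B.indicator (1 : Ω × ℝ → ℝ≥0∞)) := measurable_one.indicator hB
  set G : Ω × ℝ → ℝ≥0∞ := {z : Ω × ℝ | d < z.2 + 2 * Q z.1}.indicator
        (fun z => ENNReal.ofReal (z.2 + Q z.1) * B.indicator 1 (rebound ψ P z.1 z.2)) with hG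
  have hGm : Measurable G := by
    refine Measurable.indicator ?_ (measurableSet_lt measurable_const (by fun_prop))
    exact (by fun_prop : Measurable fun z : Ω × ℝ => ENNReal.ofReal (z.2 + Q z.1)).mul
      (hone.comp h.measurable_rebound)
  -- At fixed incoming velocity, pass from `ω` to the impact phase; the new density is `v (1 - Q σ /
  -- v) = w + Q σ` with `w = v - 2 Q σ`.
  have key : ∀ v : ℝ, ∫⁻ ω, ENNReal.ofReal v *
      ({x | d < x.2} ∩ skewMap ψ P Q c ⁻¹' B).indicator 1 (ω, v) ∂μ =
      ∫⁻ σ, G (σ, v - 2 * Q σ) ∂μ := by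
    intro v
    by_cases hv : d < v
    · have hcv : c < v := hd.trans_lt hv
      have hv0 : 0 < v := h.threshold_nonneg.trans_lt hcv
      have hcov := lintegral_flow_change_of_variables (μ := μ) h.continuous_flow
        (φ := fun ω => P ω / -v) (κ := fun ω => 1 + Q ω / -v) (by fun_prop) (by fun_prop)
        (h.hasDerivAt_displacement (-v)) (fun ω => ?_) (C := b / v)
        (fun ω => by rw [div_neg, abs_neg]; exact h.abs_div_le hv0 ω)
        (g := fun ω => ENNReal.ofReal v * B.indicator 1 (skewMap ψ P Q c (ω, v)))
        ((hone.comp (h.measurable_skewMap.comp measurable_prodMk_right)).const_mul _)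
      · calc _ = ∫⁻ ω, ENNReal.ofReal v * B.indicator 1 (skewMap ψ P Q c (ω, v)) ∂μ := by
              refine lintegral_congr fun ω => ?_
              by_cases hm : skewMap ψ P Q c (ω, v) ∈ B <;> simp [hm, hv]
          _ = _ := by
              rw [← hcov]
              refine lintegral_congr fun σ => ?_
              have hmem : (σ, v - 2 * Q σ) ∈ {z : Ω × ℝ | d < z.2 + 2 * Q z.1} := by simpa using hv
              rw [hG, indicator_of_mem hmem, div_neg, div_neg, h.skewMap_of_impact σ hcv, ← mul_assoc,
                ← ENNReal.ofReal_mul' hv0.le]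
              congr 2
              field_simp
              ring
      · have := (div_lt_one hv0).2 (h.deriv_lt hcv ω)
        simp only [div_neg]
        linarith
    · refine lintegral_congr fun σ => ?_
      simp [hG, hv]
  have hDB : MeasurableSet ({x : Ω × ℝ | d < x.2} ∩ skewMap ψ P Q c ⁻¹' B) :=
    hD.inter (h.measurable_skewMap hB)
  rw [phaseMeasure_apply μ hDB]
  simp only [key]
  rw [lintegral_lintegral_swap (f := fun v σ => G (σ, v - 2 * Q σ))
    (by exact (hGm.comp (measurable_snd.prodMk (measurable_fst.sub
      ((hQm.comp measurable_snd).const_mul 2)))).aemeasurable),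
    lintegral_lintegral_swap (f := fun w σ => G (σ, w))
    (hGm.comp measurable_swap).aemeasurable]
  refine lintegral_congr fun σ => ?_
  exact lintegral_sub_right_eq_self (fun w => G (σ, w)) (2 * Q σ)

/-- At high velocities the skew map does not increase the measure of preimages. -/
theorem phaseMeasure_preimage_le (h : IsForcing ψ P Q R a b c) {d : ℝ} (hd : c ≤ d)
    (hQd : ∀ ω, -d ≤ Q ω) {B : Set (Ω × ℝ)} (hB : MeasurableSet B) (hBd : B ⊆ {x | d < x.2}) :
    phaseMeasure μ ({x | d < x.2} ∩ skewMap ψ P Q c ⁻¹' B) ≤ phaseMeasure μ B := by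
  have hPm := h.continuous_fst.measurable
  have hQm := h.continuous_deriv.measurable
  rw [h.phaseMeasure_preimage hd hB, phaseMeasure_apply μ hB]
  refine lintegral_mono fun w => ?_
  by_cases hw : d < w
  · have hw0 : 0 < w := h.threshold_nonneg.trans_lt (hd.trans_lt hw)
    have hone : Measurable fun ω => B.indicator (1 : Ω × ℝ → ℝ≥0∞) (ω, w) :=
      (measurable_one.indicator hB).comp measurable_prodMk_right
    rw [← lintegral_flow_change_of_variables (μ := μ) h.continuous_flow
        (φ := fun ω => P ω / w) (κ := fun ω => 1 + Q ω / w) (by fun_prop) (by fun_prop)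
        (h.hasDerivAt_displacement w) (fun ω => ?_) (C := b / w)
        (h.abs_div_le hw0) (hone.const_mul _)]
    · refine lintegral_mono fun σ => ?_
      -- Inequality enters only here: the restriction `d < w + 2 Q σ` on the incoming velocity is
      -- dropped.
      refine (indicator_le_self _ _ _).trans (le_of_eq ?_)
      simp only [rebound]
      rw [← mul_assoc, ← ENNReal.ofReal_mul' hw0.le]
      congr 2
      field_simp
    · have : -1 < Q ω / w := by
        rw [lt_div_iff₀ hw0]
        linarith [hQd ω]
      linarith
  · refine le_of_eq_of_le ?_ zero_le
    refine (lintegral_congr fun σ => ?_).trans lintegral_zero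
    have : rebound ψ P σ w ∉ B := fun hmem => hw (hBd hmem)
    simp [this]

/-- The skew map pulls null sets back to null sets. -/
theorem phaseMeasure_preimage_eq_zero (h : IsForcing ψ P Q R a b c)
    {N : Set (Ω × ℝ)} (hN : MeasurableSet N) (hNc : N ⊆ {x | c < x.2})
    (hN0 : phaseMeasure μ N = 0) :
    phaseMeasure μ ({x | c < x.2} ∩ skewMap ψ P Q c ⁻¹' N) = 0 := by
  have hPm := h.continuous_fst.measurable
  have hQ := h.continuous_deriv
  have hone : Measurable (N.indicator (1 : Ω × ℝ → ℝ≥0∞)) := measurable_one.indicator hN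
  rw [phaseMeasure_apply μ hN, lintegral_eq_zero_iff] at hN0
  · rw [h.phaseMeasure_preimage le_rfl hN]
    refine (lintegral_congr_ae ?_).trans lintegral_zero
    filter_upwards [hN0] with w hw
    by_cases hcw : c < w
    · have hw0 : 0 < w := h.threshold_nonneg.trans_lt hcw
      have hNw : MeasurableSet {ω | (ω, w) ∈ N} := measurable_prodMk_right hN
      have hNw0 : μ {ω | (ω, w) ∈ N} = 0 := by
        rw [← lintegral_indicator_one hNw]
        have hw' : ∫⁻ ω, ENNReal.ofReal w * N.indicator 1 (ω, w) ∂μ = 0 := hw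
        rw [lintegral_const_mul (f := fun ω => N.indicator 1 (ω, w)) _
          (hone.comp measurable_prodMk_right)] at hw'
        exact (mul_eq_zero.1 hw').resolve_left (by simpa using hw0)
      have hz := measure_flow_preimage_eq_zero (μ := μ) h.continuous_flow
        (φ := fun ω => P ω / w) (κ := fun ω => 1 + Q ω / w) (by fun_prop) (by fun_prop)
        (h.hasDerivAt_displacement w) hNw hNw0
      refine (lintegral_congr_ae ?_).trans lintegral_zero
      filter_upwards [measure_eq_zero_iff_ae_notMem.1 hz] with σ hσ
      refine indicator_apply_eq_zero.2 fun hmem => ?_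
      have hmem' : c < w + 2 * Q σ := hmem
      -- `w + Q σ` is the mean of the outgoing velocity `w` and the incoming velocity `w + 2 Q σ`,
      -- both positive.
      have hpos : 1 + Q σ / w ≠ 0 := by
        have : 0 < w + Q σ := by linarith [h.threshold_nonneg]
        have : 1 + Q σ / w = (w + Q σ) / w := by field_simp
        rw [this]
        positivity
      have : rebound ψ P σ w ∉ N := fun hm => hσ ⟨hpos, hm⟩
      simp [this]
    · refine (lintegral_congr fun σ => ?_).trans lintegral_zero
      have : rebound ψ P σ w ∉ N := fun hmem => hcw (hNc hmem)
      simp [this]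
  · have : Measurable fun z : ℝ × Ω => ENNReal.ofReal z.1 * N.indicator 1 (z.2, z.1) := by
      exact (by fun_prop : Measurable fun z : ℝ × Ω => ENNReal.ofReal z.1).mul
        (hone.comp measurable_swap)
    exact this.lintegral_prod_right'

end IsForcing

end Dynamics

/-! ### Adiabatic invariance of the action -/

/-- Second order Taylor expansion at `0` with a bound on the oscillation of the second
derivative. -/
theorem abs_taylor_remainder_le {p p' p'' : ℝ → ℝ} (hp : ∀ s, HasDerivAt p (p' s) s)
    (hp' : ∀ s, HasDerivAt p' (p'' s) s) {δ u : ℝ}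
    (hδ : ∀ s, |s| ≤ |u| → |p'' s - p'' 0| ≤ δ) :
    |p u - p 0 - p' 0 * u - p'' 0 * u ^ 2 / 2| ≤ δ * u ^ 2 := by
  have hδ0 : 0 ≤ δ := (abs_nonneg _).trans (hδ 0 (by simp))
  have hconv : Convex ℝ (Icc (-|u|) |u|) := convex_Icc _ _
  have h0 : (0 : ℝ) ∈ Icc (-|u|) |u| := by simp
  have hu : u ∈ Icc (-|u|) |u| := abs_le.1 le_rfl
  have hfirst : ∀ s ∈ Icc (-|u|) |u|, |p' s - p' 0 - p'' 0 * s| ≤ δ * |u| := by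
    intro s hs
    have := hconv.norm_image_sub_le_of_norm_hasDerivWithin_le
      (f := fun s => p' s - p'' 0 * s) (f' := fun s => p'' s - p'' 0 * 1) (C := δ)
      (fun x _ => ((hp' x).sub ((hasDerivAt_id x).const_mul (p'' 0))).hasDerivWithinAt)
      (fun x hx => by simpa using hδ x (abs_le.2 hx)) h0 hs
    simp only [Real.norm_eq_abs, mul_zero, sub_zero] at this
    calc |p' s - p' 0 - p'' 0 * s| = |p' s - p'' 0 * s - p' 0| := by ring_nf
      _ ≤ δ * |s| := this
      _ ≤ δ * |u| := mul_le_mul_of_nonneg_left (abs_le.2 hs) hδ0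
  have := hconv.norm_image_sub_le_of_norm_hasDerivWithin_le
      (f := fun s => p s - p' 0 * s - p'' 0 * s ^ 2 / 2)
      (f' := fun s => p' s - p' 0 - p'' 0 * s) (C := δ * |u|)
      (fun x _ => by
        have := ((hp x).sub ((hasDerivAt_id x).const_mul (p' 0))).sub
          (((hasDerivAt_pow 2 x).const_mul (p'' 0)).div_const 2)
        refine (this.congr_deriv ?_).hasDerivWithinAt
        push_cast
        ring)
      hfirst h0 hu
  simp only [Real.norm_eq_abs, mul_zero, sub_zero, ne_eq, OfNat.ofNat_ne_zero, not_false_eq_true,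
    zero_pow, zero_div] at this
  calc |p u - p 0 - p' 0 * u - p'' 0 * u ^ 2 / 2|
      = |p u - p' 0 * u - p'' 0 * u ^ 2 / 2 - p 0| := by ring_nf
    _ ≤ δ * |u| * |u| := this
    _ = δ * u ^ 2 := by rw [mul_assoc, abs_mul_abs_self, sq]

section Adiabatic

variable {Ω : Type*} [AddCommGroup Ω] [TopologicalSpace Ω]

/-- The action `P v`, an adiabatic invariant of the ping-pong map. -/
def action (P : Ω → ℝ) (x : Ω × ℝ) : ℝ := P x.1 * x.2

namespace IsForcing

variable {ψ : ℝ →+ Ω} {P Q R : Ω → ℝ} {a b c : ℝ}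

theorem taylor (h : IsForcing ψ P Q R a b c) (σ : Ω) {δ u : ℝ}
    (hδ : ∀ s, |s| ≤ |u| → |R (σ + ψ s) - R σ| ≤ δ) :
    |P (σ + ψ u) - P σ - Q σ * u - R σ * u ^ 2 / 2| ≤ δ * u ^ 2 := by
  simpa using abs_taylor_remainder_le (h.hasDerivAt σ) (h.hasDerivAt₂ σ) (u := u) (δ := δ)
    (by simpa using hδ)

/-- Every phase point above the threshold comes from a phase of impact. -/
theorem exists_impact (h : IsForcing ψ P Q R a b c) {x : Ω × ℝ} (hx : c < x.2) :
    ∃ σ, x.1 = σ + ψ (-(P σ / x.2)) ∧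
      skewMap ψ P Q c x = rebound ψ P σ (x.2 - 2 * Q σ) := by
  have hv0 : x.2 ≠ 0 := (h.threshold_nonneg.trans_lt hx).ne'
  refine ⟨x.1 + ψ (flightTime ψ P c x), ?_, by simp [skewMap, hx]⟩
  rw [← h.flightTime_mul hx, mul_div_cancel_right₀ _ hv0, map_neg, add_neg_cancel_right]

/-- Expanding at the impact, with `A₀` and `A₁` the values of `P` at times `-p / v` and `p / v₁`,
the terms of order zero and one cancel because `v₁ = v - 2 q`. The quadratic terms leave `r p² q /
(v v₁)`, and the remainders contribute the terms in `δ`. -/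
theorem abs_action_sub_le_of_taylor {p q r v v₁ A₀ A₁ M b δ : ℝ} (hv : 0 < v) (hδ : 0 ≤ δ)
    (hv₁ : v₁ = v - 2 * q) (hv₁v : v / 2 ≤ v₁) (hp : 0 ≤ p) (hpb : p ≤ b) (hq : |q| ≤ M)
    (hr : |r| ≤ M)
    (h₀ : |A₀ - p - q * -(p / v) - r * (-(p / v)) ^ 2 / 2| ≤ δ * (-(p / v)) ^ 2)
    (h₁ : |A₁ - p - q * (p / v₁) - r * (p / v₁) ^ 2 / 2| ≤ δ * (p / v₁) ^ 2) :
    |A₁ * v₁ - A₀ * v| ≤ (2 * M ^ 2 * b ^ 2 / v + 3 * δ * b ^ 2) / v := by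
  have hv₁0 : 0 < v₁ := by linarith
  set e₀ := A₀ - p - q * -(p / v) - r * (-(p / v)) ^ 2 / 2 with he₀
  set e₁ := A₁ - p - q * (p / v₁) - r * (p / v₁) ^ 2 / 2 with he₁
  have hM : 0 ≤ M := (abs_nonneg q).trans hq
  have hpb2 : p ^ 2 ≤ b ^ 2 := pow_le_pow_left₀ hp hpb 2
  have hsplit : A₁ * v₁ - A₀ * v = r * p ^ 2 * q / (v * v₁) + e₁ * v₁ - e₀ * v := by
    rw [he₀, he₁]
    have hq' : q = (v - v₁) / 2 := by linarith
    rw [hq']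
    field_simp
    ring
  have hmain : |r * p ^ 2 * q / (v * v₁)| ≤ 2 * M ^ 2 * b ^ 2 / v / v := by
    rw [abs_div, abs_mul, abs_mul, abs_of_pos (mul_pos hv hv₁0), abs_of_nonneg (sq_nonneg p),
      div_le_iff₀ (mul_pos hv hv₁0)]
    calc |r| * p ^ 2 * |q| ≤ M * b ^ 2 * M := by gcongr
      _ = 2 * M ^ 2 * b ^ 2 / v / v * (v * (v / 2)) := by field_simp
      _ ≤ 2 * M ^ 2 * b ^ 2 / v / v * (v * v₁) := by gcongr
  have hE₁ : |e₁ * v₁| ≤ 2 * (δ * b ^ 2) / v := by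
    rw [abs_mul, abs_of_pos hv₁0]
    calc |e₁| * v₁ ≤ δ * (p / v₁) ^ 2 * v₁ := by gcongr
      _ = δ * p ^ 2 / v₁ := by field_simp
      _ ≤ δ * p ^ 2 / (v / 2) := by gcongr
      _ ≤ δ * b ^ 2 / (v / 2) := by gcongr
      _ = 2 * (δ * b ^ 2) / v := by field_simp
  have hE₀ : |e₀ * v| ≤ δ * b ^ 2 / v := by
    rw [abs_mul, abs_of_pos hv]
    calc |e₀| * v ≤ δ * (-(p / v)) ^ 2 * v := by gcongr
      _ = δ * p ^ 2 / v := by field_simp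
      _ ≤ δ * b ^ 2 / v := by gcongr
  rw [hsplit]
  calc |r * p ^ 2 * q / (v * v₁) + e₁ * v₁ - e₀ * v|
      ≤ |r * p ^ 2 * q / (v * v₁)| + |e₁ * v₁| + |e₀ * v| :=
        (abs_sub _ _).trans (add_le_add_left (abs_add_le _ _) _)
    _ ≤ 2 * M ^ 2 * b ^ 2 / v / v + 2 * (δ * b ^ 2) / v + δ * b ^ 2 / v := by gcongr
    _ = (2 * M ^ 2 * b ^ 2 / v + 3 * δ * b ^ 2) / v := by ring

theorem exists_deriv_bound [CompactSpace Ω] (h : IsForcing ψ P Q R a b c) :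
    ∃ M, 0 < M ∧ ∀ ω, |Q ω| ≤ M ∧ |R ω| ≤ M := by
  obtain ⟨M₁, h₁⟩ := isCompact_univ.exists_bound_of_continuousOn h.continuous_deriv.continuousOn
  obtain ⟨M₂, h₂⟩ := isCompact_univ.exists_bound_of_continuousOn h.continuous_deriv₂.continuousOn
  refine ⟨max (max M₁ M₂) 1, by positivity, fun ω => ⟨?_, ?_⟩⟩
  · exact (h₁ ω (mem_univ ω)).trans ((le_max_left _ _).trans (le_max_left _ _))
  · exact (h₂ ω (mem_univ ω)).trans ((le_max_right _ _).trans (le_max_left _ _))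

theorem exists_oscillation_le [CompactSpace Ω] [IsTopologicalAddGroup Ω]
    (h : IsForcing ψ P Q R a b c) {δ : ℝ} (hδ : 0 < δ) :
    ∃ η > 0, ∀ t, |t| ≤ η → ∀ ω, |R (ω + ψ t) - R ω| ≤ δ := by
  have hR := h.continuous_deriv₂
  have hψ := h.continuous_flow
  have hev : ∀ᶠ t in 𝓝 (0 : ℝ), ∀ ω ∈ (univ : Set Ω), |R (ω + ψ t) - R ω| < δ := by
    refine isCompact_univ.eventually_forall_of_forall_eventually fun ω _ => ?_
    have hc : Continuous fun z : ℝ × Ω => |R (z.2 + ψ z.1) - R z.2| := by fun_prop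
    exact hc.continuousAt.eventually (Iio_mem_nhds (by simpa using hδ))
  obtain ⟨η, hη, hball⟩ := Metric.eventually_nhds_iff.1 hev
  refine ⟨η / 2, half_pos hη, fun t ht ω => (hball ?_ ω (mem_univ ω)).le⟩
  rw [Real.dist_eq, sub_zero]
  linarith

/-- The action changes by `o(1 / v)` in one step. -/
theorem exists_abs_action_sub_le [CompactSpace Ω] [IsTopologicalAddGroup Ω]
    (h : IsForcing ψ P Q R a b c) {ε : ℝ} (hε : 0 < ε) :
    ∃ V, c < V ∧ ∀ x : Ω × ℝ, V ≤ x.2 →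
      |action P (skewMap ψ P Q c x) - action P x| ≤ ε / x.2 := by
  obtain ⟨M, hM, hQR⟩ := h.exists_deriv_bound
  have hb : 0 < b := (h.P_pos 0).trans_le (h.upper 0)
  have hc := h.threshold_nonneg
  obtain ⟨η, hη, hosc⟩ := h.exists_oscillation_le (δ := ε / (6 * b ^ 2)) (by positivity)
  have hV₁ : 0 < 4 * M ^ 2 * b ^ 2 / ε := by positivity
  have hV₂ : 0 < 2 * b / η := by positivity
  -- The summands in turn: the map is defined; the rebound at most halves the velocity; the
  -- quadratic term is at most `ε / 2`; both flight times are at most `η`. The choice of `δ` makes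
  -- the Taylor remainders cost another `ε / 2`.
  refine ⟨c + 4 * M + 4 * M ^ 2 * b ^ 2 / ε + 2 * b / η, by linarith, fun x hx => ?_⟩
  have hv : 0 < x.2 := by linarith
  obtain ⟨σ, hσ, hmap⟩ := h.exists_impact (x := x) (by linarith)
  have hq := abs_le.1 (hQR σ).1
  have hw : x.2 / 2 ≤ x.2 - 2 * Q σ := by linarith
  have hw0 : 0 < x.2 - 2 * Q σ := by linarith
  have hη' : 2 * b / x.2 ≤ η := by
    rw [div_le_iff₀ hv]
    have : 2 * b / η ≤ x.2 := by linarith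
    rw [div_le_iff₀ hη] at this
    linarith
  have hu₀ : |-(P σ / x.2)| ≤ η := by
    rw [abs_neg]
    refine (h.abs_div_le hv σ).trans (le_trans ?_ hη')
    gcongr
    linarith
  have hu₁ : |P σ / (x.2 - 2 * Q σ)| ≤ η := by
    refine (h.abs_div_le hw0 σ).trans (le_trans ?_ hη')
    rw [div_le_div_iff₀ hw0 hv]
    nlinarith
  have key := abs_action_sub_le_of_taylor hv (by positivity : 0 ≤ ε / (6 * b ^ 2)) rfl hw
    (h.P_pos σ).le (h.upper σ) (hQR σ).1 (hQR σ).2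
    (h.taylor σ fun s hs => hosc s (hs.trans hu₀) σ)
    (h.taylor σ fun s hs => hosc s (hs.trans hu₁) σ)
  rw [← hσ] at key
  rw [hmap]
  refine key.trans ?_
  gcongr
  have h₁ : 2 * M ^ 2 * b ^ 2 / x.2 ≤ ε / 2 := by
    have : 4 * M ^ 2 * b ^ 2 / ε ≤ x.2 := by linarith
    rw [div_le_iff₀ hε] at this
    rw [div_le_iff₀ hv]
    linarith
  have h₂ : 3 * (ε / (6 * b ^ 2)) * b ^ 2 = ε / 2 := by
    field_simp
    norm_num
  linarith

variable [MeasurableSpace Ω]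

/-- Strips between two levels of the action. -/
theorem phaseMeasure_strip_le [BorelSpace Ω] (h : IsForcing ψ P Q R a b c) (μ : Measure Ω)
    [SFinite μ] {k η : ℝ} (hk : 0 ≤ k) (hη : 0 ≤ η) {d : ℝ} (hd : c ≤ d) :
    phaseMeasure μ {x | d < x.2 ∧ k ≤ action P x ∧ action P x ≤ k + η} ≤
      ENNReal.ofReal (η * (k + η) / a ^ 2) * μ univ := by
  have hPm := h.continuous_fst.measurable
  have hact : Measurable (action P) := (hPm.comp measurable_fst).mul measurable_snd
  have ha := h.pos
  set S := {x : Ω × ℝ | d < x.2 ∧ k ≤ action P x ∧ action P x ≤ k + η} with hS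
  have hSm : MeasurableSet S :=
    (measurableSet_lt measurable_const measurable_snd).inter
      ((measurableSet_le measurable_const hact).inter (measurableSet_le hact measurable_const))
  have hvle : ∀ x ∈ S, ENNReal.ofReal x.2 ≤ ENNReal.ofReal ((k + η) / a) := by
    rintro x ⟨hx, -, hx'⟩
    have hx0 : 0 < x.2 := h.threshold_nonneg.trans_lt (hd.trans_lt hx)
    refine ENNReal.ofReal_le_ofReal ((le_div_iff₀ ha).2 ?_)
    refine le_trans ?_ hx'
    rw [action, mul_comm]
    exact mul_le_mul_of_nonneg_right (h.lower x.1) hx0.le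
  have hslice : ∀ ω, volume (Prod.mk ω ⁻¹' S) ≤ ENNReal.ofReal (η / a) := by
    intro ω
    have hP := h.P_pos ω
    have hsub : Prod.mk ω ⁻¹' S ⊆ Icc (k / P ω) ((k + η) / P ω) := by
      rintro v ⟨-, h₁, h₂⟩
      simp only [action] at h₁ h₂
      exact ⟨(div_le_iff₀ hP).2 (by linarith), (le_div_iff₀ hP).2 (by linarith)⟩
    refine (measure_mono hsub).trans ?_
    rw [Real.volume_Icc]
    refine ENNReal.ofReal_le_ofReal ?_
    rw [← sub_div, add_sub_cancel_left]
    exact div_le_div_of_nonneg_left hη ha (h.lower ω)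
  calc phaseMeasure μ S = ∫⁻ x in S, ENNReal.ofReal x.2 ∂(μ.prod volume) :=
        withDensity_apply _ hSm
    _ ≤ ∫⁻ _ in S, ENNReal.ofReal ((k + η) / a) ∂(μ.prod volume) :=
        setLIntegral_mono measurable_const hvle
    _ = ENNReal.ofReal ((k + η) / a) * (μ.prod volume) S := setLIntegral_const _ _
    _ ≤ ENNReal.ofReal ((k + η) / a) * ∫⁻ _, ENNReal.ofReal (η / a) ∂μ := by
        rw [Measure.prod_apply hSm]
        gcongr
        exact hslice _
    _ = ENNReal.ofReal (η * (k + η) / a ^ 2) * μ univ := by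
        rw [lintegral_const, ← mul_assoc, ← ENNReal.ofReal_mul (by positivity)]
        congr 2
        field_simp

end IsForcing

end Adiabatic

/-! ### Escaping orbits -/

section Escape

variable {Ω : Type*} [AddCommGroup Ω]

/-- The points of the phase space whose forward orbit stays above the velocity `d` and has
velocities tending to infinity. -/
def skewEscaping (ψ : ℝ →+ Ω) (P Q : Ω → ℝ) (c d : ℝ) : Set (Ω × ℝ) :=
  {x | (∀ n, d < ((skewMap ψ P Q c)^[n] x).2) ∧
    Tendsto (fun n => ((skewMap ψ P Q c)^[n] x).2) atTop atTop}

/-- The escaping points that have an action of at most `m`, but never again. -/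
def lastBelow (ψ : ℝ →+ Ω) (P Q : Ω → ℝ) (c d m : ℝ) : Set (Ω × ℝ) :=
  {x | x ∈ skewEscaping ψ P Q c d ∧ action P x ≤ m ∧
    ∀ n, m < action P ((skewMap ψ P Q c)^[n + 1] x)}

theorem iterate_mem_skewEscaping {ψ : ℝ →+ Ω} {P Q : Ω → ℝ} {c d : ℝ} {x : Ω × ℝ}
    (hx : x ∈ skewEscaping ψ P Q c d) (i : ℕ) :
    (skewMap ψ P Q c)^[i] x ∈ skewEscaping ψ P Q c d := by
  constructor
  · intro n
    rw [← Function.iterate_add_apply]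
    exact hx.1 _
  · simp only [← Function.iterate_add_apply]
    exact hx.2.comp (tendsto_add_atTop_nat i)

theorem exists_iterate_mem_skewEscaping {ψ : ℝ →+ Ω} {P Q : Ω → ℝ} {c d : ℝ} {x : Ω × ℝ}
    (hx : x ∈ skewEscaping ψ P Q c c) :
    ∃ n, (skewMap ψ P Q c)^[n] x ∈ skewEscaping ψ P Q c d := by
  obtain ⟨K, hK⟩ := eventually_atTop.1 (hx.2.eventually_gt_atTop d)
  refine ⟨K, fun n => ?_, (iterate_mem_skewEscaping hx K).2⟩
  rw [← Function.iterate_add_apply]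
  exact hK _ (by omega)

namespace IsForcing

variable [TopologicalSpace Ω] {ψ : ℝ →+ Ω} {P Q R : Ω → ℝ} {a b c : ℝ}

theorem tendsto_action (h : IsForcing ψ P Q R a b c) {d : ℝ} (hd : c ≤ d) {x : Ω × ℝ}
    (hx : x ∈ skewEscaping ψ P Q c d) :
    Tendsto (fun n => action P ((skewMap ψ P Q c)^[n] x)) atTop atTop := by
  refine tendsto_atTop_mono (fun n => ?_) (hx.2.const_mul_atTop h.pos)
  exact mul_le_mul_of_nonneg_right (h.lower _)
    (h.threshold_nonneg.trans (hd.trans (hx.1 n).le))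

/-- The action tends to infinity, so there is a last visit below any level above its initial value.
Integer levels keep the later union countable. -/
theorem exists_iterate_mem_lastBelow (h : IsForcing ψ P Q R a b c) {d : ℝ} (hd : c ≤ d)
    {x : Ω × ℝ} (hx : x ∈ skewEscaping ψ P Q c d) :
    ∃ n m : ℕ, (skewMap ψ P Q c)^[n] x ∈ lastBelow ψ P Q c d m := by
  obtain ⟨m, hm⟩ := exists_nat_ge (action P x)
  obtain ⟨K, hK⟩ := (eventually_atTop.1 ((h.tendsto_action hd hx).eventually_gt_atTop (m : ℝ)))
  classical
  let n := Nat.findGreatest (fun n => action P ((skewMap ψ P Q c)^[n] x) ≤ m) K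
  have hn : action P ((skewMap ψ P Q c)^[n] x) ≤ m :=
    Nat.findGreatest_spec (P := fun n => action P ((skewMap ψ P Q c)^[n] x) ≤ m)
      (Nat.zero_le K) hm
  refine ⟨n, m, iterate_mem_skewEscaping hx n, hn, fun i => ?_⟩
  rw [← Function.iterate_add_apply]
  rcases le_total (i + 1 + n) K with hle | hge
  · exact not_le.1 (Nat.findGreatest_is_greatest
      (P := fun n => action P ((skewMap ψ P Q c)^[n] x) ≤ m) (by omega) hle)
  · exact hK _ hge

/-- An orbit that escapes to infinity crosses each high level of the action through a thin
strip. -/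
theorem exists_iterate_mem_strip (h : IsForcing ψ P Q R a b c) {d : ℝ} (hd : c ≤ d)
    {M ε V k : ℝ} (hM : ∀ ω, |Q ω| ≤ M) (hε : 0 ≤ ε)
    (hV : ∀ x : Ω × ℝ, V ≤ x.2 → |action P (skewMap ψ P Q c x) - action P x| ≤ ε / x.2)
    (hk : 0 < k) (hkM : 4 * b * M ≤ k) (hkV : 2 * b * V ≤ k)
    {x : Ω × ℝ} (hx : x ∈ skewEscaping ψ P Q c d) (hxk : action P x < k) :
    ∃ n, (skewMap ψ P Q c)^[n + 1] x ∈
      {x | d < x.2 ∧ k ≤ action P x ∧ action P x ≤ k + 2 * b * ε / k} := by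
  classical
  have hb : 0 < b := (h.P_pos 0).trans_le (h.upper 0)
  -- Stop at the first time the action reaches `k`; the previous action is below `k`, so the
  -- overshoot is at most one jump.
  have hex : ∃ n, k ≤ action P ((skewMap ψ P Q c)^[n] x) :=
    ((h.tendsto_action hd hx).eventually_ge_atTop k).exists
  obtain ⟨n, hn⟩ : ∃ n, Nat.find hex = n + 1 := by
    refine Nat.exists_eq_succ_of_ne_zero fun h0 => ?_
    have := Nat.find_spec hex
    rw [h0] at this
    exact absurd hxk (not_lt.2 this)
  have hhigh : k ≤ action P ((skewMap ψ P Q c)^[n + 1] x) := hn ▸ Nat.find_spec hex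
  have hlow : action P ((skewMap ψ P Q c)^[n] x) < k :=
    not_le.1 (Nat.find_min hex (by omega))
  refine ⟨n, hx.1 _, hhigh, ?_⟩
  have hv₁ := hx.1 (n + 1)
  have hv := hx.1 n
  rw [Function.iterate_succ_apply'] at hhigh hv₁ ⊢
  set y := (skewMap ψ P Q c)^[n] x with hy
  obtain ⟨σ, -, hmap⟩ := h.exists_impact (hd.trans_lt hv)
  have hv₁0 : 0 < (skewMap ψ P Q c y).2 := h.threshold_nonneg.trans_lt (hd.trans_lt hv₁)
  have hkb : k / b ≤ (skewMap ψ P Q c y).2 := by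
    rw [div_le_iff₀ hb]
    refine hhigh.trans ?_
    rw [action, mul_comm]
    exact mul_le_mul_of_nonneg_left (h.upper _) hv₁0.le
  have hy₂ : (skewMap ψ P Q c y).2 = y.2 - 2 * Q σ := by rw [hmap]; rfl
  have hMk : 4 * M ≤ k / b := by
    rw [le_div_iff₀ hb]
    linarith
  -- The velocity after the crossing is at least `k / b`, and the rebound changed it by at most `2 M
  -- ≤ k / (2 b)`.
  have hyk : k / (2 * b) ≤ y.2 := by
    have h₁ := (abs_le.1 (hM σ)).1
    have h₂ : k / (2 * b) = k / b / 2 := by rw [mul_comm, div_div]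
    linarith
  have hyV : V ≤ y.2 := by
    refine le_trans ?_ hyk
    rw [le_div_iff₀ (by positivity)]
    linarith
  have hjump := (abs_le.1 (hV y hyV)).2
  have hle : ε / y.2 ≤ 2 * b * ε / k := by
    calc ε / y.2 ≤ ε / (k / (2 * b)) := by gcongr
      _ = 2 * b * ε / k := by field_simp
  linarith

variable [MeasurableSpace Ω] [BorelSpace Ω] [IsTopologicalAddGroup Ω] [SecondCountableTopology Ω]

theorem measurableSet_skewEscaping (h : IsForcing ψ P Q R a b c) (d : ℝ) :
    MeasurableSet (skewEscaping ψ P Q c d) := by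
  have hf : ∀ n, Measurable fun x => ((skewMap ψ P Q c)^[n] x).2 := fun n =>
    measurable_snd.comp (h.measurable_skewMap.iterate n)
  refine MeasurableSet.inter ?_ (measurableSet_tendsto atTop hf)
  exact measurableSet_setOfPred.2 (Measurable.forall fun n =>
    measurableSet_setOfPred.1 (measurableSet_lt measurable_const (hf n)))

theorem measurableSet_lastBelow (h : IsForcing ψ P Q R a b c) (d m : ℝ) :
    MeasurableSet (lastBelow ψ P Q c d m) := by
  have hact : Measurable (action P) :=
    (h.continuous_fst.measurable.comp measurable_fst).mul measurable_snd
  refine (h.measurableSet_skewEscaping d).inter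
    ((measurableSet_le hact measurable_const).inter ?_)
  exact measurableSet_setOfPred.2 (Measurable.forall fun n => measurableSet_setOfPred.1
    (measurableSet_lt measurable_const (hact.comp (h.measurable_skewMap.iterate (n + 1)))))

variable [CompactSpace Ω] (μ : Measure Ω) [IsFiniteMeasure μ] [μ.IsAddLeftInvariant]

/-- The set is wandering, since later actions exceed `m`, and all its orbits cross a strip of
measure `O(ε)`. -/
theorem phaseMeasure_lastBelow (h : IsForcing ψ P Q R a b c) {d M : ℝ} (hd : c ≤ d)
    (hMd : M ≤ d) (hM : ∀ ω, |Q ω| ≤ M) (m : ℝ) :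
    phaseMeasure μ (lastBelow ψ P Q c d m) = 0 := by
  have hPm := h.continuous_fst.measurable
  have ha := h.pos
  have hb : 0 < b := (h.P_pos 0).trans_le (h.upper 0)
  have hact : Measurable (action P) := (hPm.comp measurable_fst).mul measurable_snd
  have hbound : ∀ ε : ℝ, 0 < ε → phaseMeasure μ (lastBelow ψ P Q c d m) ≤
      ENNReal.ofReal (2 * b * ε * (1 + 2 * b * ε) / a ^ 2) * μ univ := by
    intro ε hε
    obtain ⟨V, -, hV⟩ := h.exists_abs_action_sub_le hε
    obtain ⟨k, hk⟩ := exists_gt (max (max (4 * b * M) (2 * b * V)) (max m 1))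
    simp only [max_lt_iff] at hk
    obtain ⟨⟨hk₁, hk₂⟩, hk₃, hk₄⟩ := hk
    have hk0 : 0 < k := by linarith
    have hη : 0 ≤ 2 * b * ε / k := by positivity
    have hle : phaseMeasure μ (lastBelow ψ P Q c d m) ≤ phaseMeasure μ
        {x | d < x.2 ∧ k ≤ action P x ∧ action P x ≤ k + 2 * b * ε / k} := by
      refine measure_le_of_wandering _ h.measurable_skewMap (D := {x | d < x.2})
        (measurableSet_lt measurable_const measurable_snd)
        (fun B hB hBd => h.phaseMeasure_preimage_le hd (fun ω => ?_) hB hBd)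
        (h.measurableSet_lastBelow d m) (fun x hx n => hx.1.1 n)
        (fun x hx n hn => not_le.2 (hx.2.2 n) hn.2.1) ?_ (fun x hx => hx.1)
        (fun x hx => h.exists_iterate_mem_strip hd hM hε.le hV hk0 hk₁.le hk₂.le hx.1
          (hx.2.1.trans_lt hk₃))
      · have := (abs_le.1 (hM ω)).1
        linarith
      · exact (measurableSet_lt measurable_const measurable_snd).inter
          ((measurableSet_le measurable_const hact).inter (measurableSet_le hact measurable_const))
    refine hle.trans ((h.phaseMeasure_strip_le μ hk0.le hη hd).trans ?_)
    gcongr ENNReal.ofReal (?_ / _) * _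
    calc 2 * b * ε / k * (k + 2 * b * ε / k) = 2 * b * ε * (1 + 2 * b * ε / k ^ 2) := by
          field_simp
      _ ≤ 2 * b * ε * (1 + 2 * b * ε) := by
          gcongr
          exact div_le_self (by positivity) (one_le_pow₀ hk₄.le)
  have hlim : Tendsto (fun ε : ℝ =>
      ENNReal.ofReal (2 * b * ε * (1 + 2 * b * ε) / a ^ 2) * μ univ) (𝓝[>] 0) (𝓝 0) := by
    have hc : Continuous fun ε : ℝ => 2 * b * ε * (1 + 2 * b * ε) / a ^ 2 := by fun_prop
    have h₁ : Tendsto (fun ε : ℝ => ENNReal.ofReal (2 * b * ε * (1 + 2 * b * ε) / a ^ 2))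
        (𝓝 0) (𝓝 0) := by
      simpa [Function.comp_def] using (ENNReal.continuous_ofReal.comp hc).tendsto 0
    have := ENNReal.Tendsto.mul_const (b := μ univ) h₁ (Or.inr (measure_ne_top μ univ))
    rw [zero_mul] at this
    exact this.mono_left nhdsWithin_le_nhds
  refine le_antisymm (ge_of_tendsto hlim ?_) zero_le
  filter_upwards [self_mem_nhdsWithin] with ε hε
  exact hbound ε hε

theorem phaseMeasure_skewEscaping (h : IsForcing ψ P Q R a b c) :
    phaseMeasure μ (skewEscaping ψ P Q c c) = 0 := by
  obtain ⟨M, hM, hQR⟩ := h.exists_deriv_bound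
  set d := max c M
  have hd : c ≤ d := le_max_left _ _
  have hE := h.measurableSet_skewEscaping c
  have hmeas : ∀ n (m : ℕ), MeasurableSet (skewEscaping ψ P Q c c ∩
      (skewMap ψ P Q c)^[n] ⁻¹' lastBelow ψ P Q c d m) := fun n m =>
    hE.inter ((h.measurable_skewMap.iterate n) (h.measurableSet_lastBelow d m))
  have hnull : ∀ n (m : ℕ), phaseMeasure μ (skewEscaping ψ P Q c c ∩
      (skewMap ψ P Q c)^[n] ⁻¹' lastBelow ψ P Q c d m) = 0 := by
    intro n m
    induction n with
    | zero =>
      exact measure_mono_null inter_subset_right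
        (h.phaseMeasure_lastBelow μ hd (le_max_right _ _) (fun ω => (hQR ω).1) m)
    | succ n ih =>
      -- Orbits may spend time between `c` and `d`, where the measure bound is not at hand; nullity
      -- of preimages suffices.
      refine measure_mono_null ?_ (h.phaseMeasure_preimage_eq_zero (hmeas n m)
        (fun x hx => hx.1.1 0) ih)
      exact fun x hx => ⟨hx.1.1 0, iterate_mem_skewEscaping hx.1 1, hx.2⟩
  refine measure_mono_null ?_ (measure_iUnion_null fun n => measure_iUnion_null (hnull n))
  intro x hx
  obtain ⟨i, hi⟩ := exists_iterate_mem_skewEscaping (d := d) hx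
  obtain ⟨n, m, hnm⟩ := h.exists_iterate_mem_lastBelow hd hi
  rw [← Function.iterate_add_apply] at hnm
  exact mem_iUnion.2 ⟨n + i, mem_iUnion.2 ⟨m, hx, hnm⟩⟩

/-- Almost every lift of the skew map has an escaping set of measure zero. -/
theorem ae_volume_escapingSet (h : IsForcing ψ P Q R a b c) :
    ∀ᵐ ω ∂μ, volume (escapingSet (fun t => P (ω + ψ t)) c) = 0 := by
  have hψm := h.continuous_flow.measurable
  set E := skewEscaping ψ P Q c c with hEdef
  have hE : MeasurableSet E := h.measurableSet_skewEscaping c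
  have hE0 : (μ.prod volume) E = 0 := by
    have hwd := h.phaseMeasure_skewEscaping μ
    rw [phaseMeasure, withDensity_apply_eq_zero (by fun_prop)] at hwd
    -- The density `v` is positive on `E`, so null for `v dv dμ` means null for the product measure.
    refine measure_mono_null (fun x hx => mem_inter ?_ hx) hwd
    have : 0 < x.2 := h.threshold_nonneg.trans_lt (hx.1 0)
    simpa using this
  have hlift : MeasurableSet {z : Ω × (ℝ × ℝ) | (z.1 + ψ z.2.1, z.2.2) ∈ E} := by
    have : Measurable fun z : Ω × (ℝ × ℝ) => (z.1 + ψ z.2.1, z.2.2) := by fun_prop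
    exact this hE
  have hlift0 : (μ.prod (volume : Measure (ℝ × ℝ)))
      {z : Ω × (ℝ × ℝ) | (z.1 + ψ z.2.1, z.2.2) ∈ E} = 0 := by
    have hEv : ∀ᵐ v : ℝ, μ {ω | (ω, v) ∈ E} = 0 := by
      rw [Measure.prod_apply_symm hE, lintegral_eq_zero_iff
        (measurable_measure_prodMk_right hE)] at hE0
      exact hE0
    rw [Measure.prod_apply_symm hlift, Measure.volume_eq_prod,
      lintegral_prod _ (measurable_measure_prodMk_right hlift).aemeasurable]
    refine (lintegral_congr fun t => ?_).trans lintegral_zero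
    refine (lintegral_congr_ae ?_).trans lintegral_zero
    filter_upwards [hEv] with v hv
    exact (measure_preimage_add_right μ (ψ t) {ω | (ω, v) ∈ E}).trans hv
  filter_upwards [Measure.measure_ae_null_of_prod_null hlift0] with ω hω
  refine measure_mono_null (fun x hx => ?_) hω
  have hit := fun n => h.skewMap_lift_iterate ω (x := x) n fun i _ => hx.1 i
  change (ω + ψ x.1, x.2) ∈ E
  constructor
  · intro n
    rw [hit n]
    exact hx.1 n
  · simp only [hit]
    exact hx.2

end IsForcing

end Escape

/-! ### From the class `C²_ψ` to a forcing -/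

section Regularity

variable {Ω : Type*} [AddCommGroup Ω]

theorem FlowDifferentiable.hasDerivAt {ψ : ℝ →+ Ω} {U : Ω → ℝ} (hU : FlowDifferentiable ψ U)
    (ω : Ω) (s : ℝ) : HasDerivAt (fun t : ℝ => U (ω + ψ t)) (flowDeriv ψ U (ω + ψ s)) s := by
  have h : HasDerivAt (fun t : ℝ => U (ω + ψ s + ψ t)) (flowDeriv ψ U (ω + ψ s)) (s - s) := by
    rw [sub_self]
    exact (hU (ω + ψ s)).hasDerivAt
  refine (h.comp_sub_const s s).congr_of_eventuallyEq (Eventually.of_forall fun t => ?_)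
  simp only [add_assoc, ← map_add, add_sub_cancel]

theorem IsCPsi.isForcing [TopologicalSpace Ω] [CompactSpace Ω] {ψ : ℝ →+ Ω} (hψ : Continuous ψ) {P : Ω → ℝ}
    (hP : IsCPsi ψ 2 P) {a b : ℝ} (ha : 0 < a) (hPab : ∀ ω, a ≤ P ω ∧ P ω ≤ b) :
    IsForcing ψ P (flowDeriv ψ P) (flowDeriv ψ (flowDeriv ψ P)) a b (vStar ψ P) := by
  obtain ⟨hc, hd, hc', hd', hc''⟩ := hP
  refine ⟨hψ, hc, hc', hc'', hd.hasDerivAt, hd'.hasDerivAt, ha, fun ω => (hPab ω).1,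
    fun ω => (hPab ω).2, ?_, fun ω => ?_⟩
  · exact mul_nonneg zero_le_two (le_max_right _ _)
  · refine mul_le_mul_of_nonneg_left (le_trans ?_ (le_max_left _ _)) zero_le_two
    exact le_ciSup (isCompact_range hc').bddAbove ω

end Regularity

end PingPong

theorem theorem5p1 {Ω : Type*} [AddCommGroup Ω] [TopologicalSpace Ω] [IsTopologicalAddGroup Ω]
    [CompactSpace Ω] [TopologicalSpace.MetrizableSpace Ω] [MeasurableSpace Ω] [BorelSpace Ω]
    (μ : MeasureTheory.Measure Ω) [μ.IsAddHaarMeasure]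
    (ψ : ℝ →+ Ω) (hψ : Continuous ψ) (hψd : DenseRange ψ)
    (a b : ℝ) (ha : 0 < a) (hab : a < b)
    (P : Ω → ℝ) (hP : PingPong.IsCPsi ψ 2 P) (hPab : ∀ ω, a ≤ P ω ∧ P ω ≤ b) :
    ∀ᵐ ω ∂μ, MeasureTheory.volume
      (PingPong.escapingSet (fun t : ℝ => P (ω + ψ t)) (PingPong.vStar ψ P)) = 0 := by
  -- A compact metric space is second countable, as the measurability arguments require.
  let := TopologicalSpace.metrizableSpaceMetric Ω
  exact (hP.isForcing hψ ha hPab).ae_volume_escapingSet μ
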